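/- Let $A$ and $B$ be unital $C^*$-algebras, let $d\in\mathbb{N}$, and let $s=(s_1,\dots,s_d)\in A^d$ and $r=(r_1,\dots,r_d)\in B^d$ be tuples of unitaries. Write $\mathcal{S}(s)\subseteq A$ for the operator system generated by $s$ (the linear span of $1$, the $s_i$ and the $s_i^*$), $C^*(s)\subseteq A$ for the unital $C^*$-algebra generated by $s$, and similarly $\mathcal{S}(r)\subseteq C^*(r)\subseteq B$. Positivity in $M_n(\mathcal{S}(s))$ and $M_n(C^*(s))$ is that of $M_n(A)$, and similarly for $B$; a linear map is UCP (unital completely positive) if it is unital and its entrywise amplification to $n\times n$ matrices is positive for every $n$. A UCP map $\phi:\mathcal{S}(s)\to B$ has the unique extension property if it has exactly one UCP extension $\Phi:C^*(s)\to B$ and this $\Phi$ is a $*$-homomorphism. 1. If $\phi:\mathcal{S}(s)\to\mathcal{S}(r)$ is a UCP map with $\phi(s_i)=r_i$ for all $i$, then $\phi$, viewed as a map into $B$, has the unique extension property. 2. There is a complete order isomorphism $\phi:\mathcal{S}(s)\to\mathcal{S}(r)$ (a unital linear bijection such that $\phi$ and $\phi^{-1}$ are completely positive) with $\phi(s_i)=r_i$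 for all $i$ if and only if there is a $*$-isomorphism $\pi:C^*(s)\to C^*(r)$ with $\pi(s_i)=r_i$ for all $i$. 3. If $\phi$ is a complete order isomorphism as in 2, then there is a $*$-isomorphism $\pi:C^*(s)\to C^*(r)$ which, viewed as a map into $B$, is the unique UCP extension of $\phi$ to $C^*(s)$. -/

import Mathlib

/-- An operator system in a unital C⋆-algebra `A`: a linear subspace of `A` that contains the unit
and is closed under the `⋆`-operation. -/
structure OperatorSystem (A : Type*) [CStarAlgebra A] extends Submodule ℂ A where
  one_mem' : (1 : A) ∈ carrier
  star_mem' : ∀ {a : A}, a ∈ carrier → star a ∈ carrier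

namespace OperatorSystem

section Basic

variable {A : Type*} [CStarAlgebra A]

instance instSetLike : SetLike (OperatorSystem A) A where
  coe S := S.carrier
  coe_injective := by
    rintro ⟨S, _, _⟩ ⟨T, _, _⟩ h
    congr
    exact SetLike.coe_injective h

instance instAddSubmonoidClass : AddSubmonoidClass (OperatorSystem A) A where
  zero_mem S := S.toSubmodule.zero_mem
  add_mem {S} _ _ ha hb := S.toSubmodule.add_mem ha hb

instance instSMulMemClass : SMulMemClass (OperatorSystem A) ℂ A where
  smul_mem {S} c _ ha := S.toSubmodule.smul_mem c ha

instance instOneMemClass : OneMemClass (OperatorSystem A) A where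
  one_mem S := S.one_mem'

instance instStarMemClass : StarMemClass (OperatorSystem A) A where
  star_mem {S} _ ha := S.star_mem' ha

/-- The operator system `𝒮(s)` generated by a tuple `s`: the linear span of the unit, the entries
of `s` and their adjoints. -/
noncomputable def generatedBy {d : ℕ} (s : Fin d → A) : OperatorSystem A where
  toSubmodule := Submodule.span ℂ ({1} ∪ Set.range s ∪ Set.range fun i => star (s i))
  one_mem' := Submodule.subset_span (Or.inl (Or.inl rfl))
  star_mem' := by
    intro a ha
    change a ∈ Submodule.span ℂ ({1} ∪ Set.range s ∪ Set.range fun i => star (s i)) at ha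
    change star a ∈ Submodule.span ℂ ({1} ∪ Set.range s ∪ Set.range fun i => star (s i))
    induction ha using Submodule.span_induction with
    | mem x hx =>
      rcases hx with (rfl | ⟨i, rfl⟩) | ⟨i, rfl⟩
      · rw [star_one]
        exact Submodule.subset_span (Or.inl (Or.inl rfl))
      · exact Submodule.subset_span (Or.inr ⟨i, rfl⟩)
      · change star (star (s i)) ∈ _
        rw [star_star]
        exact Submodule.subset_span (Or.inl (Or.inr ⟨i, rfl⟩))
    | zero => rw [star_zero]; exact Submodule.zero_mem _
    | add x y _ _ hx hy => rw [star_add]; exact Submodule.add_mem _ hx hy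
    | smul c x _ hx => rw [star_smul]; exact Submodule.smul_mem _ _ hx

theorem mem_generatedBy {d : ℕ} (s : Fin d → A) (i : Fin d) : s i ∈ generatedBy s :=
  Submodule.subset_span (Or.inl (Or.inr ⟨i, rfl⟩))

/-- The entry `s i`, as an element of `𝒮(s)`. -/
def gen {d : ℕ} (s : Fin d → A) (i : Fin d) : generatedBy s := ⟨s i, mem_generatedBy s i⟩

/-- `𝒮(s)` is the smallest operator system that contains all entries of `s`. -/
theorem generatedBy_subset {d : ℕ} (s : Fin d → A) (T : OperatorSystem A) (h : ∀ i, s i ∈ T)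
    {a : A} (ha : a ∈ generatedBy s) : a ∈ T := by
  have hle : Submodule.span ℂ ({1} ∪ Set.range s ∪ Set.range fun i => star (s i))
      ≤ T.toSubmodule := by
    rw [Submodule.span_le]
    rintro x ((rfl | ⟨i, rfl⟩) | ⟨i, rfl⟩)
    · exact T.one_mem'
    · exact h i
    · exact T.star_mem' (h i)
  exact hle ha

/-- The C⋆-algebra `C⋆(S)` generated by an operator system `S ⊆ A`: the norm closure in `A` of the
`⋆`-algebra generated by `S`. -/
def cstar (S : OperatorSystem A) : StarSubalgebra ℂ A :=
  (StarAlgebra.adjoin ℂ (S : Set A)).topologicalClosure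

theorem mem_cstar (S : OperatorSystem A) {a : A} (ha : a ∈ S) : a ∈ S.cstar :=
  (StarAlgebra.adjoin ℂ (S : Set A)).le_topologicalClosure (StarAlgebra.subset_adjoin ℂ _ ha)

/-- The inclusion of `S` into `C⋆(S)`. -/
def toCstar (S : OperatorSystem A) (x : S) : S.cstar := ⟨x, S.mem_cstar x.2⟩

/-- `C⋆(𝒮(s))` is the C⋆-algebra `C⋆(s)` generated by the entries of `s` and the unit. -/
theorem cstar_generatedBy {d : ℕ} (s : Fin d → A) :
    (generatedBy s).cstar = (StarAlgebra.adjoin ℂ (Set.range s)).topologicalClosure := by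
  refine le_antisymm (StarSubalgebra.topologicalClosure_mono ?_)
    (StarSubalgebra.topologicalClosure_mono ?_)
  · refine StarAlgebra.adjoin_le fun a ha => ?_
    let T : OperatorSystem A :=
      { toSubmodule := Subalgebra.toSubmodule (StarAlgebra.adjoin ℂ (Set.range s)).toSubalgebra
        one_mem' := one_mem (StarAlgebra.adjoin ℂ (Set.range s))
        star_mem' := fun h => (StarAlgebra.adjoin ℂ (Set.range s)).star_mem' h }
    exact generatedBy_subset s T (fun i => StarAlgebra.subset_adjoin ℂ _ ⟨i, rfl⟩) ha
  · refine StarAlgebra.adjoin_le ?_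
    rintro _ ⟨i, rfl⟩
    exact StarAlgebra.subset_adjoin ℂ _ (mem_generatedBy s i)

end Basic

section Maps

variable {A B : Type*} [CStarAlgebra A] [PartialOrder A] [StarOrderedRing A]
  [CStarAlgebra B] [PartialOrder B] [StarOrderedRing B]
  {σ : Type*} [SetLike σ A]

/-- A map `φ : S → B` from a subset `S` of `A` (an operator system or a C⋆-subalgebra) to `B` is
`n`-positive if its entrywise amplification maps every matrix in `Mₙ(S)` that is positive in `Mₙ(A)`
to a positive matrix in `Mₙ(B)`. -/
def IsNPositive {S : σ} (n : ℕ) (φ : S → B) : Prop :=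
  ∀ M : CStarMatrix (Fin n) (Fin n) S, 0 ≤ M.map ((↑) : S → A) → 0 ≤ M.map φ

/-- A linear map `φ : S → B` is UCP if it is unital and `n`-positive for all `n`. -/
structure IsUCP [AddSubmonoidClass σ A] [SMulMemClass σ ℂ A] [OneMemClass σ A] {S : σ}
    (φ : S →ₗ[ℂ] B) : Prop where
  map_one : φ 1 = 1
  nPositive : ∀ n, IsNPositive n φ

/-- A linear map between operator systems `S ⊆ A` and `R ⊆ B`, viewed as a map into `B`. -/
noncomputable def toAmbient {S : OperatorSystem A} {R : OperatorSystem B} (φ : S →ₗ[ℂ] R) : S →ₗ[ℂ] B where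
  toFun x := φ x
  map_add' x y := by rw [map_add]; rfl
  map_smul' c x := by rw [map_smul]; rfl

/-- A linear bijection `φ : S → R` between operator systems is a complete order isomorphism if it
is unital and both `φ` and `φ⁻¹` are `n`-positive for all `n`. -/
structure IsCompleteOrderIso {S : OperatorSystem A} {R : OperatorSystem B} (φ : S ≃ₗ[ℂ] R) :
    Prop where
  map_one : φ 1 = 1
  nPositive : ∀ n, IsNPositive n (fun x : S => (φ x : B))
  nPositive_symm : ∀ n, IsNPositive n (fun y : R => (φ.symm y : A))

/-- A UCP map `Φ : C⋆(S) → B` which extends `φ : S → B`. -/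
structure IsUCPExtension {S : OperatorSystem A} (φ : S →ₗ[ℂ] B) (Φ : S.cstar →ₗ[ℂ] B) :
    Prop where
  isUCP : IsUCP Φ
  extends_map : ∀ x : S, Φ (S.toCstar x) = φ x

/-- A map `φ : S → B` has the unique extension property if it has a unique UCP extension to
`C⋆(S)`, and this extension is a `⋆`-homomorphism. -/
def HasUniqueExtensionProperty {S : OperatorSystem A} (φ : S →ₗ[ℂ] B) : Prop :=
  (∃! Φ : S.cstar →ₗ[ℂ] B, IsUCPExtension φ Φ) ∧
    ∀ Φ : S.cstar →ₗ[ℂ] B, IsUCPExtension φ Φ → ∃ π : S.cstar →⋆ₐ[ℂ] B, ∀ a, π a = Φ a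

end Maps

end OperatorSystem

/-! The crux is that a UCP map `φ` on `𝒮(s)` with `s i ↦ r i` is already norm-decreasing on all
noncommutative `⋆`-polynomials in the unitaries. Work with its graph in `A × B`, the span of the
finite self-adjoint set `U` consisting of `1`, the pairs `(s i, r i)` and their adjoints. Complete
positivity of `φ` says that this span is completely monotone (`MatMono`).

Monotonicity passes from `span U` to `span (U * U)` by linearization (`MatMono.span_mul`). Since the
elements of `U` are unitary, a matrix over `span (U * U)` is a compression `Vᴴ * a * V` with `a`
scalar and `V` an isometry over `span U` (`exists_eq_compression`). If such a compression is
strictly positive, then for a large `t` so is, in the weak sense, the block matrix with rows `(a +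
t, t V)` and `(t Vᴴ, t)`, whose entries lie in `span U`; conversely, positivity of the block matrix
gives positivity of the compression. Iterating reaches the whole `⋆`-algebra generated by `U`,
although the matrix size grows at each step, which is why complete positivity is needed.

Applied to `‖x.1‖² - star x * x` this gives `‖x.2‖ ≤ ‖x.1‖`, so the closure of that `⋆`-algebra
contains the graph of a `⋆`-homomorphism on `C⋆(s)` extending `φ`. Uniqueness is a multiplicative
domain argument: a UCP map sending unitary generators to unitaries is multiplicative
(`IsUCP.map_mul_of_unitary`, `IsUCP.eq_starAlgHom`). The isomorphism statements follow by applying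
both results to `φ` and its inverse. -/

namespace OperatorSystem

open scoped Matrix

/-! ### Positive matrices over a C⋆-algebra. -/

section MatPos

variable {A : Type*} [CStarAlgebra A] [PartialOrder A] [StarOrderedRing A]
  {m n : Type*} [Fintype m] [Fintype n]

/-- Positivity of a square matrix over a C⋆-algebra. -/
def MatPos (M : Matrix n n A) : Prop := (0 : CStarMatrix n n A) ≤ CStarMatrix.ofMatrix M

theorem MatPos.add {M N : Matrix n n A} (hM : MatPos M) (hN : MatPos N) : MatPos (M + N) :=
  add_nonneg (α := CStarMatrix n n A) hM hN

theorem MatPos.smul {M : Matrix n n A} (hM : MatPos M) {c : ℝ} (hc : 0 ≤ c) :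
    MatPos (c • M) := by
  classical
  exact smul_nonneg (β := CStarMatrix n n A) hc hM

theorem MatPos.isHermitian {M : Matrix n n A} (hM : MatPos M) : Mᴴ = M :=
  IsSelfAdjoint.of_nonneg (R := CStarMatrix n n A) hM

theorem MatPos.sum {ι : Type*} (t : Finset ι) {M : ι → Matrix n n A} (h : ∀ i ∈ t, MatPos (M i)) :
    MatPos (∑ i ∈ t, M i) :=
  Finset.sum_nonneg (N := CStarMatrix n n A) h

theorem MatPos.eq_zero {M : Matrix n n A} (hM : MatPos M) (hM' : MatPos (-M)) : M = 0 :=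
  le_antisymm (α := CStarMatrix n n A) (neg_nonneg.mp hM') hM

theorem matPos_conjTranspose_mul_self_of_square (X : Matrix n n A) : MatPos (Xᴴ * X) :=
  star_mul_self_nonneg (R := CStarMatrix n n A) X

theorem _root_.CStarAlgebra.exists_eq_star_mul_self {C : Type*} [CStarAlgebra C] [PartialOrder C]
    [StarOrderedRing C] {a : C} (ha : 0 ≤ a) : ∃ b, a = star b * b :=
  CStarAlgebra.nonneg_iff_eq_star_mul_self.mp ha

theorem MatPos.exists_eq {M : Matrix n n A} (hM : MatPos M) : ∃ N : Matrix n n A, M = Nᴴ * N := by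
  classical
  exact CStarAlgebra.exists_eq_star_mul_self (C := CStarMatrix n n A) hM

theorem matPos_conjTranspose_mul_self (X : Matrix m n A) : MatPos (Xᴴ * X) := by
  classical
  rcases isEmpty_or_nonempty n with h | ⟨⟨i₀⟩⟩
  · rw [Subsingleton.elim (Xᴴ * X) 0]
    exact le_refl (0 : CStarMatrix n n A)
  -- Each row of `X` is placed in row `i₀` of a square matrix, reducing to the C⋆-algebra of square
  -- matrices.
  · let Y : m → Matrix n n A := fun k => Matrix.of fun i j => if i = i₀ then X k j else 0
    have : Xᴴ * X = ∑ k, (Y k)ᴴ * Y k := by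
      ext i j
      simp [Matrix.mul_apply, Matrix.sum_apply, Y]
    rw [this]
    exact MatPos.sum _ fun k _ => matPos_conjTranspose_mul_self_of_square _

theorem matPos_mul_conjTranspose_self (X : Matrix m n A) : MatPos (X * Xᴴ) := by
  simpa using matPos_conjTranspose_mul_self Xᴴ

theorem MatPos.conjTranspose_mul_mul {M : Matrix n n A} (hM : MatPos M) (X : Matrix n m A) :
    MatPos (Xᴴ * M * X) := by
  obtain ⟨N, rfl⟩ := hM.exists_eq
  simpa [Matrix.mul_assoc] using matPos_conjTranspose_mul_self (N * X)

theorem MatPos.mul_mul_conjTranspose {M : Matrix n n A} (hM : MatPos M) (X : Matrix m n A) :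
    MatPos (X * M * Xᴴ) := by
  simpa using hM.conjTranspose_mul_mul Xᴴ

theorem MatPos.submatrix {M : Matrix n n A} (hM : MatPos M) (f : m → n) :
    MatPos (M.submatrix f f) := by
  classical
  obtain ⟨N, rfl⟩ := hM.exists_eq
  have : (Nᴴ * N).submatrix f f = (N.submatrix id f)ᴴ * N.submatrix id f := by
    ext i j; simp [Matrix.mul_apply]
  rw [this]
  exact matPos_conjTranspose_mul_self _

theorem MatPos.diag_nonneg {M : Matrix n n A} (hM : MatPos M) (i : n) : 0 ≤ M i i := by
  obtain ⟨N, rfl⟩ := hM.exists_eq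
  rw [Matrix.mul_apply]
  exact Finset.sum_nonneg fun j _ => star_mul_self_nonneg _

theorem matPos_of_unique [Unique n] {M : Matrix n n A} (h : 0 ≤ M default default) :
    MatPos M := by
  obtain ⟨x, hx⟩ := CStarAlgebra.nonneg_iff_eq_star_mul_self.mp h
  have : M = (Matrix.of fun _ _ : n => x)ᴴ * Matrix.of fun _ _ => x := by
    ext i j
    rw [Unique.eq_default i, Unique.eq_default j, hx]
    simp [Matrix.mul_apply]
  rw [this]
  exact matPos_conjTranspose_mul_self _

/-- The positive cone is closed; let `ε` tend to `0` from the right. -/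
theorem matPos_of_forall_pos_add [DecidableEq n] {M : Matrix n n A}
    (h : ∀ ε : ℝ, 0 < ε → MatPos (M + ε • (1 : Matrix n n A))) : MatPos M := by
  have hc : Continuous fun ε : ℝ =>
      (CStarMatrix.ofMatrix M + ε • (1 : CStarMatrix n n A) : CStarMatrix n n A) := by fun_prop
  have hlim := (hc.tendsto 0).mono_left (nhdsWithin_le_nhds (s := Set.Ioi 0))
  have hz : (CStarMatrix.ofMatrix M + (0 : ℝ) • (1 : CStarMatrix n n A) : CStarMatrix n n A)
      = CStarMatrix.ofMatrix M := by simp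
  rw [hz] at hlim
  exact (CStarAlgebra.isClosed_nonneg (A := CStarMatrix n n A)).mem_of_tendsto hlim
    (Filter.eventually_of_mem self_mem_nhdsWithin fun ε hε => h ε hε)

-- Cauchy–Schwarz for positive matrices: with `M = Nᴴ * N` the hypothesis reads `(N * X)ᴴ * (N * X)
-- = 0`, and its diagonal entries force `N * X = 0`.
omit [Fintype m] in
theorem MatPos.mul_eq_zero {M : Matrix n n A} (hM : MatPos M) {X : Matrix n m A}
    (h : Xᴴ * M * X = 0) : M * X = 0 := by
  obtain ⟨N, rfl⟩ := hM.exists_eq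
  have h1 : (N * X)ᴴ * (N * X) = 0 := by simpa [Matrix.mul_assoc] using h
  have h2 : N * X = 0 := by
    ext k j
    have h3 := congrFun (congrFun h1 j) j
    rw [Matrix.mul_apply, Matrix.zero_apply] at h3
    have h4 := (Finset.sum_eq_zero_iff_of_nonneg
      (fun i _ => star_mul_self_nonneg ((N * X) i j))).mp h3 k (Finset.mem_univ k)
    exact CStarRing.star_mul_self_eq_zero_iff _ |>.mp h4
  rw [Matrix.mul_assoc, h2, Matrix.mul_zero]

end MatPos

/-! ### Linearization: compressions by isometries as positive linear pencils. -/

section Pencil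

variable {C : Type*} [CStarAlgebra C] [PartialOrder C] [StarOrderedRing C]

/-- A self-adjoint element with strictly positive compression to the range of a projection `p`
becomes positive after adding a large multiple of `1 - p`. -/
theorem exists_nonneg_add_smul_one_sub {a p : C} (ha : IsSelfAdjoint a) (hp : IsStarProjection p)
    {ε : ℝ} (hε : 0 < ε) (h : 0 ≤ p * a * p - ε • p) :
    ∃ t : ℝ, 0 ≤ t ∧ 0 ≤ a + t • (1 - p) := by
  have hpp : p * p = p := hp.isIdempotentElem
  have hps : star p = p := hp.isSelfAdjoint
  have has : star a = a := ha
  -- Schur complement relative to `p`: completing the square with `x` below absorbs the off-diagonal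
  -- corners of `a` and leaves `-b` compressed to `1 - p`, so `t = ‖b‖` suffices.
  let b : C := ε⁻¹ • (a * p * a) - a
  have hb : IsSelfAdjoint b := by
    simp [b, IsSelfAdjoint, hps, has, mul_assoc]
  refine ⟨‖b‖, norm_nonneg _, ?_⟩
  have h1 : 0 ≤ algebraMap ℝ C ‖b‖ - b := sub_nonneg.mpr hb.le_algebraMap_norm_self
  have h2 := star_left_conjugate_nonneg h1 (1 - p)
  let x : C := p + ε⁻¹ • (p * a * (1 - p))
  have h3 : 0 ≤ ε • (star x * x) := smul_nonneg hε.le (star_mul_self_nonneg x)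
  have hpp' : ∀ y, p * (p * y) = p * y := fun y => by rw [← mul_assoc, hpp]
  have key : a + ‖b‖ • (1 - p)
      = (p * a * p - ε • p) + ε • (star x * x)
        + star (1 - p) * (algebraMap ℝ C ‖b‖ - b) * (1 - p) := by
    have e1 : ε * ε⁻¹ = 1 := mul_inv_cancel₀ hε.ne'
    have e2 : ε * (ε⁻¹ * ε⁻¹) = ε⁻¹ := by rw [← mul_assoc, e1, one_mul]
    simp only [x, b, Algebra.algebraMap_eq_smul_one, star_add, star_sub, star_one, star_mul,
      star_smul, hps, has, star_trivial, mul_add, add_mul, mul_sub, sub_mul, mul_one, one_mul,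
      smul_add, smul_sub, mul_smul_comm, smul_mul_assoc, smul_smul, mul_assoc, hpp, hpp', e1, e2,
      one_smul]
    abel
  rw [key]
  exact add_nonneg (add_nonneg h h3) h2

end Pencil

section Block

variable {A : Type*} [CStarAlgebra A] [PartialOrder A] [StarOrderedRing A]
  {m n : Type*} [Fintype m] [Fintype n] [DecidableEq m] [DecidableEq n]

/-- The range projection `V * Vᴴ` has `a` strictly positive on it, so `a + t (1 - V * Vᴴ)` is
positive for some `t`. Adding `t` times the square of the column `(V, 1)` makes the block matrix
linear in `V`. -/
theorem exists_matPos_fromBlocks {a : Matrix m m A} (ha : aᴴ = a) {V : Matrix m n A}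
    (hV : Vᴴ * V = 1) {ε : ℝ} (hε : 0 < ε) (h : MatPos (Vᴴ * a * V - ε • (1 : Matrix n n A))) :
    ∃ t : ℝ, MatPos (Matrix.fromBlocks (a + t • (1 : Matrix m m A)) (t • V) (t • Vᴴ)
      (t • (1 : Matrix n n A))) := by
  have hp : IsStarProjection (R := CStarMatrix m m A) (V * Vᴴ : Matrix m m A) := by
    constructor
    · change V * Vᴴ * (V * Vᴴ) = V * Vᴴ
      rw [Matrix.mul_assoc, ← Matrix.mul_assoc Vᴴ, hV, Matrix.one_mul]
    · change (V * Vᴴ)ᴴ = V * Vᴴ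
      simp
  have h0 := h.mul_mul_conjTranspose V
  have h1 : V * (Vᴴ * a * V - ε • (1 : Matrix n n A)) * Vᴴ
      = V * Vᴴ * a * (V * Vᴴ) - ε • (V * Vᴴ) := by
    simp [Matrix.mul_sub, Matrix.sub_mul, Matrix.mul_assoc]
  rw [h1] at h0
  obtain ⟨t, ht, hpos⟩ := exists_nonneg_add_smul_one_sub (C := CStarMatrix m m A) (a := a) ha hp hε h0
  have hpos' : MatPos (a + t • (1 - V * Vᴴ)) := hpos
  refine ⟨t, ?_⟩
  have key : Matrix.fromBlocks (a + t • (1 : Matrix m m A)) (t • V) (t • Vᴴ) (t • (1 : Matrix n n A))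
      = Matrix.fromRows (1 : Matrix m m A) (0 : Matrix n m A) * (a + t • (1 - V * Vᴴ))
          * (Matrix.fromRows (1 : Matrix m m A) (0 : Matrix n m A))ᴴ
        + t • (Matrix.fromRows V (1 : Matrix n n A) * (Matrix.fromRows V (1 : Matrix n n A))ᴴ) := by
    rw [Matrix.conjTranspose_fromRows_eq_fromCols_conjTranspose,
      Matrix.conjTranspose_fromRows_eq_fromCols_conjTranspose, Matrix.fromRows_mul,
      Matrix.fromRows_mul_fromCols, Matrix.fromRows_mul_fromCols, Matrix.fromBlocks_smul,
      Matrix.fromBlocks_add]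
    simp [smul_sub, add_sub]
  rw [key]
  exact (hpos'.mul_mul_conjTranspose _).add ((matPos_mul_conjTranspose_self _).smul ht)

/-- Conjugating by the column `(V, -1)` cancels every term in `t`, because `Vᴴ * V = 1`. -/
theorem matPos_of_fromBlocks {a : Matrix m m A} {V : Matrix m n A} (hV : Vᴴ * V = 1) {t : ℝ}
    (h : MatPos (Matrix.fromBlocks (a + t • (1 : Matrix m m A)) (t • V) (t • Vᴴ)
      (t • (1 : Matrix n n A)))) : MatPos (Vᴴ * a * V) := by
  have h1 := h.conjTranspose_mul_mul (Matrix.fromRows V (-1 : Matrix n n A))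
  rw [Matrix.conjTranspose_fromRows_eq_fromCols_conjTranspose, Matrix.fromCols_mul_fromBlocks,
    Matrix.fromCols_mul_fromRows] at h1
  convert h1 using 1
  simp [Matrix.mul_add, Matrix.mul_assoc, hV]

end Block

/-! ### Complete monotonicity, from the graph to the generated `⋆`-algebra. -/

section MatMono

open scoped Pointwise

variable {A B : Type*} [CStarAlgebra A] [PartialOrder A] [StarOrderedRing A]
  [CStarAlgebra B] [PartialOrder B] [StarOrderedRing B]

/-- A relation `G ⊆ A × B` is completely monotone if a matrix over `G` whose first component is
positive has positive second component. -/
def MatMono (G : Submodule ℂ (A × B)) : Prop :=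
  ∀ (n : ℕ) (M : Matrix (Fin n) (Fin n) (A × B)), (∀ i j, M i j ∈ G) →
    MatPos (M.map Prod.fst) → MatPos (M.map Prod.snd)

variable {G : Submodule ℂ (A × B)}

theorem MatMono.matPos (hG : MatMono G) {n : Type*} [Fintype n] {M : Matrix n n (A × B)}
    (hM : ∀ i j, M i j ∈ G) (h : MatPos (M.map Prod.fst)) : MatPos (M.map Prod.snd) := by
  let e := Fintype.equivFin n
  have h1 := hG _ (M.submatrix e.symm e.symm) (fun i j => hM _ _) (h.submatrix e.symm)
  have h2 := h1.submatrix e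
  rwa [show ((M.submatrix e.symm e.symm).map Prod.snd).submatrix e e = M.map Prod.snd by
    ext i j; simp] at h2

/-- Complete monotonicity has to be checked on Hermitian matrices only. -/
theorem matMono_of_isHermitian (hstar : ∀ x ∈ G, star x ∈ G)
    (h : ∀ (n : ℕ) (M : Matrix (Fin n) (Fin n) (A × B)), (∀ i j, M i j ∈ G) → Mᴴ = M →
      MatPos (M.map Prod.fst) → MatPos (M.map Prod.snd)) : MatMono G := by
  intro n M hM hpos
  have hfst : (M.map Prod.fst)ᴴ = M.map Prod.fst := hpos.isHermitian
  have hentry : ∀ i j, star (M j i).1 = (M i j).1 := fun i j => congrFun (congrFun hfst i) j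
  have hzero : MatPos (0 : Matrix (Fin n) (Fin n) A) := le_refl (0 : CStarMatrix _ _ A)
  -- The first component of this Hermitian matrix vanishes. Applying `h` to `K` and `-K` kills the
  -- second component too, so `M` is Hermitian in both.
  let K : Matrix (Fin n) (Fin n) (A × B) := Complex.I • (M - Mᴴ)
  have hK : ∀ i j, K i j ∈ G := fun i j =>
    G.smul_mem _ (G.sub_mem (hM i j) (hstar _ (hM j i)))
  have hKK : Kᴴ = K := by
    simp only [K, Matrix.conjTranspose_smul, Matrix.conjTranspose_sub,
      Matrix.conjTranspose_conjTranspose, Complex.star_def, Complex.conj_I, neg_smul, ← smul_neg,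
      neg_sub]
  have hK1 : K.map Prod.fst = 0 := by
    ext i j
    simp [K, hentry]
  have hKn1 : (-K).map Prod.fst = 0 := by
    ext i j
    simpa using congrFun (congrFun hK1 i) j
  have hK2 : K.map Prod.snd = 0 := by
    refine (h n K hK hKK (hK1 ▸ hzero)).eq_zero ?_
    have := h n (-K) (fun i j => G.neg_mem (hK i j)) (by rw [Matrix.conjTranspose_neg, hKK])
      (hKn1 ▸ hzero)
    exact this
  refine h n M hM ?_ hpos
  ext i j
  · exact hentry i j
  · have := congrFun (congrFun hK2 i) j
    simp only [K, Matrix.map_apply, Matrix.smul_apply, Matrix.sub_apply, Matrix.conjTranspose_apply,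
      Prod.smul_snd, Prod.snd_sub, Prod.snd_star, Matrix.zero_apply, smul_eq_zero, Complex.I_ne_zero,
      false_or, sub_eq_zero] at this
    exact this.symm

omit [PartialOrder A] [StarOrderedRing A] [PartialOrder B] [StarOrderedRing B] in
theorem one_apply_mem (hone : (1 : A × B) ∈ G) {k : Type*} [DecidableEq k] (i j : k) :
    (1 : Matrix k k (A × B)) i j ∈ G := by
  rw [Matrix.one_apply]
  split_ifs
  · exact hone
  · exact G.zero_mem

/-- Compressions, by isometries over `G`, of Hermitian matrices over `G` are matrices on which `G`
acts monotonically. -/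
theorem MatMono.matPos_compression (hG : MatMono G) (hone : (1 : A × B) ∈ G)
    (hstar : ∀ x ∈ G, star x ∈ G) {m n : Type*} [Fintype m] [Fintype n]
    [DecidableEq m] [DecidableEq n] {a : Matrix m m (A × B)} (ha : ∀ i j, a i j ∈ G) (haa : aᴴ = a)
    {V : Matrix m n (A × B)} (hV : ∀ i j, V i j ∈ G) (hVV : Vᴴ * V = 1)
    (h : MatPos ((Vᴴ * a * V).map Prod.fst)) : MatPos ((Vᴴ * a * V).map Prod.snd) := by
  have hreal : ∀ (c : ℝ) {x : A × B}, x ∈ G → c • x ∈ G := fun c x hx => by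
    simpa using G.smul_mem (c : ℂ) hx
  have hmap1 : (Vᴴ * a * V).map Prod.fst
      = (V.map Prod.fst)ᴴ * a.map Prod.fst * V.map Prod.fst := by
    ext i j
    simp [Matrix.mul_apply, Prod.fst_sum]
  have hmap2 : (Vᴴ * a * V).map Prod.snd
      = (V.map Prod.snd)ᴴ * a.map Prod.snd * V.map Prod.snd := by
    ext i j
    simp [Matrix.mul_apply, Prod.snd_sum]
  have hV1 : (V.map Prod.fst)ᴴ * V.map Prod.fst = 1 := by
    have := congrArg (fun M => M.map Prod.fst) hVV
    ext i j
    have := congrFun (congrFun this i) j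
    by_cases hij : i = j <;> simpa [Matrix.mul_apply, Prod.fst_sum, Matrix.one_apply, hij] using this
  have hV2 : (V.map Prod.snd)ᴴ * V.map Prod.snd = 1 := by
    have := congrArg (fun M => M.map Prod.snd) hVV
    ext i j
    have := congrFun (congrFun this i) j
    by_cases hij : i = j <;> simpa [Matrix.mul_apply, Prod.snd_sum, Matrix.one_apply, hij] using this
  have ha1 : (a.map Prod.fst)ᴴ = a.map Prod.fst := by
    ext i j
    exact congrArg Prod.fst (congrFun (congrFun haa i) j)
  rw [hmap1] at h
  rw [hmap2]
  -- The pencil needs strict positivity, so `a` is replaced by `a + ε`; as `V` is an isometry, this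
  -- adds exactly `ε` to the compression.
  refine matPos_of_forall_pos_add fun ε hε => ?_
  have hε1 : MatPos ((V.map Prod.fst)ᴴ * (a.map Prod.fst + ε • (1 : Matrix m m A)) * V.map Prod.fst
      - ε • (1 : Matrix n n A)) := by
    simpa [Matrix.mul_add, Matrix.add_mul, hV1] using h
  obtain ⟨t, ht⟩ := exists_matPos_fromBlocks
    (by simp [ha1] : (a.map Prod.fst + ε • (1 : Matrix m m A))ᴴ = _) hV1 hε hε1
  let N : Matrix (m ⊕ n) (m ⊕ n) (A × B) :=
    Matrix.fromBlocks (a + ε • (1 : Matrix m m (A × B)) + t • (1 : Matrix m m (A × B)))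
      (t • V) (t • Vᴴ) (t • (1 : Matrix n n (A × B)))
  have hN : ∀ i j, N i j ∈ G := by
    rintro (i | i) (j | j)
    · exact G.add_mem (G.add_mem (ha i j) (hreal _ (one_apply_mem hone i j))) (hreal _ (one_apply_mem hone i j))
    · exact hreal _ (hV i j)
    · exact hreal _ (hstar _ (hV j i))
    · exact hreal _ (one_apply_mem hone i j)
  have hN1 : N.map Prod.fst = Matrix.fromBlocks
      (a.map Prod.fst + ε • (1 : Matrix m m A) + t • (1 : Matrix m m A))
      (t • V.map Prod.fst) (t • (V.map Prod.fst)ᴴ) (t • (1 : Matrix n n A)) := by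
    ext (i | i) (j | j) <;> simp [N, Matrix.one_apply, apply_ite Prod.fst]
  have hN2 : N.map Prod.snd = Matrix.fromBlocks
      (a.map Prod.snd + ε • (1 : Matrix m m B) + t • (1 : Matrix m m B))
      (t • V.map Prod.snd) (t • (V.map Prod.snd)ᴴ) (t • (1 : Matrix n n B)) := by
    ext (i | i) (j | j) <;> simp [N, Matrix.one_apply, apply_ite Prod.snd]
  have h2 := hG.matPos hN (hN1 ▸ ht)
  rw [hN2] at h2
  have h3 := matPos_of_fromBlocks hV2 h2
  simpa [Matrix.mul_add, Matrix.add_mul, hV2] using h3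

/-- A matrix over the span of the products `u * v` of unitaries from a finite self-adjoint set `U`
with `1 ∈ U` is a compression of a scalar matrix by an isometry over the span of `U`. -/
theorem exists_eq_compression {C : Type*} [CStarAlgebra C] {U : Set C} (hfin : U.Finite)
    (hone : 1 ∈ U) (hstar : star U = U) (hunit : ∀ u ∈ U, star u * u = 1) {n : Type*} [Fintype n]
    [DecidableEq n] (M : Matrix n n C) (hM : ∀ i j, M i j ∈ Submodule.span ℂ (U * U)) :
    ∃ (a : Matrix (hfin.toFinset × n) (hfin.toFinset × n) C) (V : Matrix (hfin.toFinset × n) n C),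
      (∀ i j, a i j ∈ Submodule.span ℂ U) ∧ (∀ i j, V i j ∈ Submodule.span ℂ U) ∧
      Vᴴ * V = 1 ∧ M = Vᴴ * a * V := by
  have hU : U * U = Set.range fun p : hfin.toFinset × hfin.toFinset => star (p.1 : C) * (p.2 : C) := by
    ext x
    simp only [Set.mem_mul, Set.mem_range, Prod.exists, Subtype.exists, Set.Finite.mem_toFinset]
    constructor
    · rintro ⟨u, hu, v, hv, rfl⟩
      exact ⟨star u, by rw [← hstar]; simpa using hu, v, hv, by simp⟩
    · rintro ⟨u, hu, v, hv, rfl⟩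
      exact ⟨star u, by rw [← hstar]; simpa using hu, v, hv, rfl⟩
  simp only [hU, Submodule.mem_span_range_iff_exists_fun] at hM
  choose c hc using hM
  have : Nonempty hfin.toFinset := ⟨⟨1, by simpa using hone⟩⟩
  set N : ℝ := (Fintype.card hfin.toFinset : ℝ) with hN
  have hN0 : 0 < N := by rw [hN]; exact_mod_cast Fintype.card_pos
  have hsq : Real.sqrt N * Real.sqrt N = N := Real.mul_self_sqrt hN0.le
  have hsq0 : Real.sqrt N ≠ 0 := (Real.sqrt_pos.mpr hN0).ne'
  -- `V` stacks the diagonal blocks `u / √N` over the `N` elements `u` of `U`; then `Vᴴ * V`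
  -- averages the `star u * u = 1`. The factor `N` in `a` undoes the normalization.
  refine ⟨Matrix.of fun p q => ((N : ℂ) * c p.2 q.2 (p.1, q.1)) • (1 : C),
    Matrix.of fun p j => if p.2 = j then (Real.sqrt N)⁻¹ • (p.1 : C) else 0, ?_, ?_, ?_, ?_⟩
  · exact fun i j => Submodule.smul_mem _ _ (Submodule.subset_span hone)
  · intro i j
    simp only [Matrix.of_apply]
    split_ifs
    · have := Submodule.smul_mem (Submodule.span ℂ U) (((Real.sqrt N)⁻¹ : ℝ) : ℂ)
        (Submodule.subset_span (hfin.mem_toFinset.mp i.1.2))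
      simpa only [Complex.coe_smul] using this
    · exact Submodule.zero_mem _
  · have hu : ∀ u : hfin.toFinset, star (u : C) * u = 1 := fun u =>
      hunit _ (hfin.mem_toFinset.mp u.2)
    ext i j
    simp only [Matrix.mul_apply, Fintype.sum_prod_type, Matrix.conjTranspose_apply, Matrix.of_apply,
      Matrix.one_apply]
    by_cases hij : i = j
    · subst hij
      simp only [apply_ite star, star_zero, star_smul, star_trivial, ite_mul, zero_mul, mul_ite,
        mul_zero, Finset.sum_ite_eq', Finset.mem_univ, if_true, smul_mul_smul_comm, hu,
        Finset.sum_const, Finset.card_univ]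
      rw [← Nat.cast_smul_eq_nsmul ℝ, ← hN, smul_smul, ← mul_inv, hsq, mul_inv_cancel₀ hN0.ne',
        one_smul]
    · simp [hij, Ne.symm hij, apply_ite star]
  · ext i j
    rw [← hc i j]
    simp only [Matrix.mul_apply, Fintype.sum_prod_type, Matrix.conjTranspose_apply, Matrix.of_apply,
      apply_ite star, star_zero, star_smul, star_trivial, ite_mul, zero_mul, mul_ite, mul_zero,
      Finset.sum_ite_eq', Finset.mem_univ, if_true, Finset.sum_mul]
    rw [Finset.sum_comm]
    refine Finset.sum_congr rfl fun u _ => Finset.sum_congr rfl fun v _ => ?_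
    have hsqC : (Real.sqrt N : ℂ) * Real.sqrt N = N := by exact_mod_cast hsq
    have hsqC0 : (Real.sqrt N : ℂ) ≠ 0 := by exact_mod_cast hsq0
    simp only [mul_smul_comm, smul_mul_assoc, mul_one, ← Complex.coe_smul, smul_smul]
    congr 1
    push_cast
    rw [← hsqC]
    field_simp

theorem star_mem_span {C : Type*} [CStarAlgebra C] {W : Set C} (hW : star W = W) {x : C}
    (hx : x ∈ Submodule.span ℂ W) : star x ∈ Submodule.span ℂ W := by
  induction hx using Submodule.span_induction with
  | mem x hx => exact Submodule.subset_span (by rw [← hW]; simpa using hx)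
  | zero => simp
  | add x y _ _ hx hy => rw [star_add]; exact Submodule.add_mem _ hx hy
  | smul c x _ hx => rw [star_smul]; exact Submodule.smul_mem _ _ hx

/-- The induction step: a matrix of quadratic entries is a compression, whose positivity is tested
by a larger matrix with entries in `span U`. -/
theorem MatMono.span_mul {U : Set (A × B)} (hfin : U.Finite) (hone : 1 ∈ U) (hstar : star U = U)
    (hunit : ∀ u ∈ U, star u * u = 1) (hU : MatMono (Submodule.span ℂ U)) :
    MatMono (Submodule.span ℂ (U * U)) := by
  classical
  refine matMono_of_isHermitian (fun _ => star_mem_span (by rw [Set.star_mul, hstar])) fun n M hM hMM hpos => ?_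
  obtain ⟨a, V, ha, hV, hVV, rfl⟩ := exists_eq_compression hfin hone hstar hunit M hM
  -- The scalar matrix `a` need not be Hermitian, but its Hermitian part has the same compression
  -- since the compression is Hermitian.
  have key : Vᴴ * a * V = Vᴴ * ((2⁻¹ : ℝ) • (a + aᴴ)) * V := by
    have h1 : Vᴴ * aᴴ * V = Vᴴ * a * V := by
      simpa [Matrix.mul_assoc] using hMM
    rw [Matrix.mul_smul, Matrix.smul_mul, Matrix.mul_add, Matrix.add_mul, h1, ← two_smul ℝ,
      smul_smul]
    norm_num
  rw [key] at hpos ⊢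
  refine hU.matPos_compression (Submodule.subset_span hone) (fun _ => star_mem_span hstar) (fun i j => ?_) ?_ hV hVV
    hpos
  · have := Submodule.smul_mem (Submodule.span ℂ U) ((2⁻¹ : ℝ) : ℂ)
      (Submodule.add_mem _ (ha i j) (star_mem_span hstar (ha j i)))
    rwa [Complex.coe_smul] at this
  · simp [add_comm]

/-- Each application of `MatMono.span_mul` doubles the word length, and every `⋆`-polynomial lies in
some `span (U ^ k)`, hence in `span (U ^ 2 ^ k)`. -/
theorem matMono_adjoin {U : Set (A × B)} (hfin : U.Finite) (hone : 1 ∈ U) (hstar : star U = U)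
    (hunit : ∀ u ∈ U, star u * u = 1) (hU : MatMono (Submodule.span ℂ U)) {x : A × B}
    (hx : x ∈ StarAlgebra.adjoin ℂ U) :
    ∃ G : Submodule ℂ (A × B), MatMono G ∧ 1 ∈ G ∧ x ∈ G := by
  have hk : ∀ k : ℕ, (U ^ 2 ^ k).Finite ∧ 1 ∈ U ^ 2 ^ k ∧ star (U ^ 2 ^ k) = U ^ 2 ^ k ∧
      (∀ u ∈ U ^ 2 ^ k, star u * u = 1) ∧ MatMono (Submodule.span ℂ (U ^ 2 ^ k)) := by
    intro k
    induction k with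
    | zero => simpa only [pow_zero, pow_one] using ⟨hfin, hone, hstar, hunit, hU⟩
    | succ k ih =>
      obtain ⟨h1, h2, h3, h4, h5⟩ := ih
      rw [pow_succ, pow_mul, pow_two]
      refine ⟨h1.mul h1, ⟨1, h2, 1, h2, one_mul 1⟩, by rw [Set.star_mul, h3], ?_,
        h5.span_mul h1 h2 h3 h4⟩
      rintro _ ⟨u, hu, v, hv, rfl⟩
      simp only [star_mul]
      rw [mul_assoc, ← mul_assoc (star u), h4 u hu, one_mul, h4 v hv]
  have hmono : ∀ {k l : ℕ}, k ≤ l → Submodule.span ℂ (U ^ k) ≤ Submodule.span ℂ (U ^ l) :=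
    fun h => Submodule.span_mono (Set.pow_subset_pow_right hone h)
  have hx' : ∃ k : ℕ, x ∈ Submodule.span ℂ (U ^ k) := by
    induction hx using StarAlgebra.adjoin_induction with
    | mem x hx => exact ⟨1, Submodule.subset_span (by simpa using hx)⟩
    | algebraMap r =>
      refine ⟨1, ?_⟩
      rw [Algebra.algebraMap_eq_smul_one]
      exact Submodule.smul_mem _ _ (Submodule.subset_span (by simpa using hone))
    | add x y _ _ hx hy =>
      obtain ⟨k, hk⟩ := hx
      obtain ⟨l, hl⟩ := hy
      exact ⟨max k l, Submodule.add_mem _ (hmono (le_max_left _ _) hk)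
        (hmono (le_max_right _ _) hl)⟩
    | mul x y _ _ hx hy =>
      obtain ⟨k, hk⟩ := hx
      obtain ⟨l, hl⟩ := hy
      refine ⟨k + l, ?_⟩
      rw [pow_add, ← Submodule.span_mul_span]
      exact Submodule.mul_mem_mul hk hl
    | star x _ hx =>
      obtain ⟨k, hk⟩ := hx
      refine ⟨k, ?_⟩
      have hs : star (U ^ k) = U ^ k := by
        clear hk
        induction k with
        | zero => simp [← Set.singleton_one, Set.star_singleton]
        | succ k ih => rw [pow_succ, Set.star_mul, ih, hstar, ← pow_succ', pow_succ]
      exact star_mem_span hs hk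
  obtain ⟨k, hx⟩ := hx'
  obtain ⟨-, h2, -, -, h5⟩ := hk k
  exact ⟨_, h5, Submodule.subset_span h2, hmono Nat.lt_two_pow_self.le hx⟩

end MatMono

/-! ### The norm estimate and the `⋆`-homomorphism with the given graph. -/

section Extension

variable {A B : Type*} [CStarAlgebra A] [PartialOrder A] [StarOrderedRing A]
  [CStarAlgebra B] [PartialOrder B] [StarOrderedRing B]

theorem norm_snd_le_norm_fst {U : Set (A × B)} (hfin : U.Finite) (hone : 1 ∈ U)
    (hstar : star U = U) (hunit : ∀ u ∈ U, star u * u = 1) (hU : MatMono (Submodule.span ℂ U))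
    {x : A × B} (hx : x ∈ StarAlgebra.adjoin ℂ U) : ‖x.2‖ ≤ ‖x.1‖ := by
  -- Its first component is positive; positivity of the second bounds `‖x.2‖` by the same constant.
  let y : A × B := algebraMap ℂ (A × B) ((‖x.1‖ ^ 2 : ℝ) : ℂ) - star x * x
  have hy : y ∈ StarAlgebra.adjoin ℂ U :=
    sub_mem (algebraMap_mem _ _) (mul_mem (star_mem hx) hx)
  obtain ⟨G, hG, -, hyG⟩ := matMono_adjoin hfin hone hstar hunit hU hy
  have h1 : 0 ≤ y.1 := by
    have := CStarAlgebra.star_mul_le_algebraMap_norm_sq (a := x.1)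
    rw [← sub_nonneg] at this
    exact this
  have h2 := hG.matPos (n := Unit) (M := Matrix.of fun _ _ => y) (fun _ _ => hyG)
    (matPos_of_unique h1)
  have h3 : 0 ≤ y.2 := h2.diag_nonneg ()
  have h4 : star x.2 * x.2 ≤ algebraMap ℝ B (‖x.1‖ ^ 2) := sub_nonneg.mp h3
  have h5 := (CStarAlgebra.norm_le_iff_le_algebraMap (star x.2 * x.2) (by positivity)
    (star_mul_self_nonneg _)).mpr h4
  rw [CStarRing.norm_star_mul_self, ← pow_two] at h5
  exact (sq_le_sq₀ (norm_nonneg _) (norm_nonneg _)).mp h5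

omit [PartialOrder A] [StarOrderedRing A] [PartialOrder B] [StarOrderedRing B] in
/-- A `⋆`-subalgebra of `A × B` on which the first component dominates the second one in norm is
the graph of a `⋆`-homomorphism, defined on the closure of its projection to `A`. -/
theorem exists_starAlgHom_of_norm_le {D : StarSubalgebra ℂ (A × B)}
    (hD : ∀ x ∈ D, ‖x.2‖ ≤ ‖x.1‖) {S : StarSubalgebra ℂ A}
    (hS : S ≤ (D.map (StarAlgHom.fst ℂ A B)).topologicalClosure) :
    ∃ π : S →⋆ₐ[ℂ] B, (∀ a : S, ((a : A), π a) ∈ D.topologicalClosure) ∧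
      ∀ (a : S) (b : B), ((a : A), b) ∈ D → π a = b := by
  have hcl : ∀ x ∈ D.topologicalClosure, ‖x.2‖ ≤ ‖x.1‖ := by
    have : IsClosed {x : A × B | ‖x.2‖ ≤ ‖x.1‖} := isClosed_le (by fun_prop) (by fun_prop)
    exact fun x hx => closure_minimal (fun y hy => hD y hy) this hx
  have huniq : ∀ {a : A} {b b' : B}, (a, b) ∈ D.topologicalClosure →
      (a, b') ∈ D.topologicalClosure → b = b' := by
    intro a b b' h h'
    have := hcl _ (sub_mem h h')
    simpa [sub_eq_zero] using this
  have hrange : IsClosed (Prod.fst '' (D.topologicalClosure : Set (A × B))) := by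
    -- The norm on `A × B` is the maximum, so the first projection preserves norms on the closure of
    -- `D`, and its range is complete.
    have hiso : Isometry fun x : D.topologicalClosure => (x : A × B).1 := by
      refine AddMonoidHomClass.isometry_of_norm
        ((AddMonoidHom.fst A B).comp (AddSubmonoidClass.subtype D.topologicalClosure)) fun x => ?_
      change ‖(x : A × B).1‖ = max ‖(x : A × B).1‖ ‖(x : A × B).2‖
      exact (max_eq_left (hcl _ x.2)).symm
    have : CompleteSpace D.topologicalClosure :=
      (D.isClosed_topologicalClosure).completeSpace_coe
    have h := hiso.isClosedEmbedding.isClosed_range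
    rwa [show Set.range (fun x : D.topologicalClosure => (x : A × B).1)
      = Prod.fst '' (D.topologicalClosure : Set (A × B)) by rw [Set.image_eq_range]; rfl] at h
  have hex : ∀ a : S, ∃ b, ((a : A), b) ∈ D.topologicalClosure := by
    intro a
    have : (a : A) ∈ Prod.fst '' (D.topologicalClosure : Set (A × B)) := by
      refine closure_minimal ?_ hrange (hS a.2)
      rintro _ ⟨x, hx, rfl⟩
      exact ⟨x, D.le_topologicalClosure hx, rfl⟩
    obtain ⟨⟨a', b⟩, hb, hab⟩ := this
    exact ⟨b, hab ▸ hb⟩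
  choose f hf using hex
  refine ⟨{ toFun := f
            map_one' := huniq (hf 1) (one_mem D.topologicalClosure)
            map_mul' := fun a b => huniq (hf _) (mul_mem (hf a) (hf b))
            map_zero' := huniq (hf 0) (zero_mem D.topologicalClosure)
            map_add' := fun a b => huniq (hf _) (add_mem (hf a) (hf b))
            commutes' := fun c => huniq (hf _) (algebraMap_mem D.topologicalClosure c)
            map_star' := fun a => huniq (hf _) (star_mem (hf a)) }, hf,
    fun a b h => huniq (hf a) (D.le_topologicalClosure h)⟩

/-! ### UCP maps on unitaries, and `⋆`-homomorphisms as UCP maps. -/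

variable {σ : Type*} [SetLike σ A] [AddSubmonoidClass σ A] [SMulMemClass σ ℂ A]
  [OneMemClass σ A] {S : σ}

theorem IsUCP.matPos {φ : S →ₗ[ℂ] B} (hφ : IsUCP φ) {n : Type*} [Fintype n]
    {M : Matrix n n S} (h : MatPos (M.map ((↑) : S → A))) : MatPos (M.map φ) := by
  let e := Fintype.equivFin n
  have h1 : MatPos ((M.submatrix e.symm e.symm).map φ) :=
    hφ.nPositive _ (M.submatrix e.symm e.symm) (h.submatrix e.symm)
  have h2 := h1.submatrix e
  rwa [show ((M.submatrix e.symm e.symm).map φ).submatrix e e = M.map φ by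
    ext i j; simp] at h2

/-- The matrix with rows `(1, u)` and `(star u, 1)` is the square of the row `(1, u)`, so its image
is positive and in particular Hermitian. -/
theorem IsUCP.map_star_of_unitary {φ : S →ₗ[ℂ] B} (hφ : IsUCP φ) {u u' : S}
    (hu : star (u : A) * u = 1) (hu' : (u' : A) = star (u : A)) : φ u' = star (φ u) := by
  let M : Matrix (Fin 2) (Fin 2) S := !![1, u; u', 1]
  have hM : M.map ((↑) : S → A)
      = (!![1, (u : A)] : Matrix (Fin 1) (Fin 2) A)ᴴ * !![1, (u : A)] := by
    ext i j
    fin_cases i <;> fin_cases j <;> simp [M, hu, hu', Matrix.mul_apply]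
  have h := (hφ.matPos (M := M) (hM ▸ matPos_conjTranspose_mul_self _)).isHermitian
  have := congrFun (congrFun h 1) 0
  simpa [M] using this.symm

/-- Multiplicative domain: the square of the row `(1, u, star x)` has positive image, which the
column `(φ u, -1, 0)` annihilates as a quadratic form. By `MatPos.mul_eq_zero` it annihilates it as
a vector; the last coordinate is the claim. -/
theorem IsUCP.map_mul_of_unitary {T : StarSubalgebra ℂ A} {φ : T →ₗ[ℂ] B} (hφ : IsUCP φ) {u : T}
    (hu : star (u : A) * u = 1) (hφu : star (φ u) * φ u = 1) (x : T) :
    φ (x * u) = φ x * φ u := by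
  let Y : Matrix (Fin 1) (Fin 3) T := !![1, u, star x]
  have hM : (Yᴴ * Y).map ((↑) : T → A)
      = (Y.map ((↑) : T → A))ᴴ * Y.map ((↑) : T → A) := by
    ext i j
    simp [Matrix.mul_apply]
  have h := hφ.matPos (M := Yᴴ * Y) (hM ▸ matPos_conjTranspose_mul_self _)
  let X : Matrix (Fin 3) (Fin 1) B := !![φ u; -1; 0]
  have huT : star u * u = 1 := Subtype.ext hu
  have hstar : φ (star u) = star (φ u) := hφ.map_star_of_unitary hu rfl
  have hX : Xᴴ * (Yᴴ * Y).map φ * X = 0 := by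
    ext i j
    fin_cases i
    fin_cases j
    simp [X, Y, Matrix.mul_apply, Fin.sum_univ_three, hφ.map_one, huT, hstar, hφu]
  have := congrFun (congrFun (h.mul_eq_zero hX) 2) 0
  simp [X, Y, Matrix.mul_apply, Fin.sum_univ_three, ← sub_eq_add_neg, sub_eq_zero] at this
  exact this.symm

/-- Compressing `a` by its negative part gives `-(a⁻)³`. Its image is both positive and negative, so
injectivity yields `a⁻ = 0`. -/
theorem _root_.NonUnitalStarAlgHom.nonneg_of_map_nonneg {C D : Type*} [NonUnitalCStarAlgebra C]
    [PartialOrder C] [StarOrderedRing C] [NonUnitalCStarAlgebra D] [PartialOrder D]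
    [StarOrderedRing D] (f : C →⋆ₙₐ[ℂ] D) (hf : Function.Injective f) {a : C} (h : 0 ≤ f a) :
    0 ≤ a := by
  have ha : IsSelfAdjoint a := by
    apply hf
    rw [map_star]
    exact IsSelfAdjoint.of_nonneg h
  have h0 : 0 ≤ a⁻ := CFC.negPart_nonneg a
  have hs : star (a⁻) = a⁻ := IsSelfAdjoint.of_nonneg h0
  have h1 : a⁻ * a * a⁻ = -(a⁻ * a⁻ * a⁻) := by
    nth_rw 2 [← CFC.posPart_sub_negPart a ha]
    rw [mul_sub, CFC.negPart_mul_posPart, zero_sub, neg_mul]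
  have h2 : 0 ≤ a⁻ * a⁻ * a⁻ := by simpa [hs] using star_left_conjugate_nonneg h0 (a⁻)
  have h3 : 0 ≤ f (-(a⁻ * a⁻ * a⁻)) := by
    rw [← h1, map_mul, map_mul]
    simpa [← map_star, hs] using star_left_conjugate_nonneg h (f a⁻)
  have h4 : f (a⁻ * a⁻ * a⁻) = 0 :=
    le_antisymm (by rw [map_neg] at h3; exact neg_nonneg.mp h3) (map_nonneg f h2)
  have h5 : a⁻ * a⁻ * a⁻ = 0 := hf (by rw [h4, map_zero])
  have h6 : a⁻ * a⁻ = 0 := by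
    refine (CStarRing.star_mul_self_eq_zero_iff _).mp ?_
    rw [star_mul, hs, ← mul_assoc, h5, zero_mul]
  have h7 : a⁻ = 0 := (CStarRing.star_mul_self_eq_zero_iff _).mp (by rw [hs, h6])
  rw [← CFC.posPart_sub_negPart a ha, h7, sub_zero]
  exact CFC.posPart_nonneg a

omit [PartialOrder A] [StarOrderedRing A] in
theorem isClosed_cstar (S : OperatorSystem A) : IsClosed (S.cstar : Set A) :=
  StarSubalgebra.isClosed_topologicalClosure _

/-- Positivity is tested in matrices over `A`, whereas `π` preserves positivity in matrices over
`C⋆(S)`; the injective inclusion reflects positivity, so the two notions agree. -/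
theorem isUCP_of_starAlgHom {S : OperatorSystem A} (π : S.cstar →⋆ₐ[ℂ] B) :
    IsUCP (π.toAlgHom.toLinearMap : S.cstar →ₗ[ℂ] B) := by
  refine ⟨map_one π, fun n M hM => ?_⟩
  have := isClosed_cstar S
  let : PartialOrder S.cstar := CStarAlgebra.spectralOrder S.cstar
  have : StarOrderedRing S.cstar := CStarAlgebra.spectralOrderedRing S.cstar
  let ι : S.cstar →⋆ₙₐ[ℂ] A := S.cstar.subtype.toNonUnitalStarAlgHom
  let π' : S.cstar →⋆ₙₐ[ℂ] B := π.toNonUnitalStarAlgHom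
  have hι : Function.Injective (CStarMatrix.mapₙₐ (n := Fin n) ι) :=
    CStarMatrix.map_injective Subtype.val_injective
  have h1 : 0 ≤ M := NonUnitalStarAlgHom.nonneg_of_map_nonneg _ hι hM
  exact map_nonneg (CStarMatrix.mapₙₐ (n := Fin n) π') h1

theorem IsUCP.continuous {S : OperatorSystem A} {φ : S.cstar →ₗ[ℂ] B} (hφ : IsUCP φ) :
    Continuous φ := by
  have := isClosed_cstar S
  let : PartialOrder S.cstar := CStarAlgebra.spectralOrder S.cstar
  have : StarOrderedRing S.cstar := CStarAlgebra.spectralOrderedRing S.cstar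
  refine map_continuous (PositiveLinearMap.mk₀ φ fun x hx => ?_)
  obtain ⟨y, rfl⟩ := CStarAlgebra.exists_eq_star_mul_self hx
  have h := hφ.matPos (M := Matrix.of fun _ _ : Unit => star y * y)
    (matPos_of_unique (star_mul_self_nonneg (y : A)))
  exact h.diag_nonneg ()

end Extension

/-! ### Extension, uniqueness and isomorphism for systems generated by unitaries. -/

section Generated

variable {A B : Type*} [CStarAlgebra A] [PartialOrder A] [StarOrderedRing A]
  [CStarAlgebra B] [PartialOrder B] [StarOrderedRing B] {d : ℕ} {s : Fin d → A} {r : Fin d → B}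

omit [PartialOrder A] [StarOrderedRing A] in
theorem span_induction_generatedBy {p : generatedBy s → Prop} (one : p 1) (gen : ∀ i, p (gen s i))
    (star_gen : ∀ i, p ⟨star (s i), star_mem (mem_generatedBy s i)⟩)
    (add : ∀ x y, p x → p y → p (x + y)) (smul : ∀ (c : ℂ) x, p x → p (c • x))
    (x : generatedBy s) : p x := by
  obtain ⟨a, ha⟩ := x
  change a ∈ Submodule.span ℂ ({1} ∪ Set.range s ∪ Set.range fun i => star (s i)) at ha
  induction ha using Submodule.span_induction with
  | mem x hx =>
    rcases hx with (rfl | ⟨i, rfl⟩) | ⟨i, rfl⟩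
    · exact one
    · exact gen i
    · exact star_gen i
  | zero =>
    have := smul 0 1 one
    rw [zero_smul] at this
    exact this
  | add x y hx hy h1 h2 => exact add ⟨x, hx⟩ ⟨y, hy⟩ h1 h2
  | smul c x hx h => exact smul c ⟨x, hx⟩ h

theorem IsUCP.matMono {S : OperatorSystem A} {φ : S →ₗ[ℂ] B} (hφ : IsUCP φ)
    {G : Submodule ℂ (A × B)} (hG : ∀ x ∈ G, ∃ y : S, (y : A) = x.1 ∧ φ y = x.2) :
    MatMono G := by
  intro n M hM h
  choose y hy1 hy2 using fun i j => hG _ (hM i j)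
  have e1 : (Matrix.of y).map ((↑) : S → A) = M.map Prod.fst := by
    ext i j; exact hy1 i j
  have e2 : (Matrix.of y).map φ = M.map Prod.snd := by
    ext i j; exact hy2 i j
  rw [← e2]
  exact hφ.matPos (e1 ▸ h)

/-- A UCP map on `𝒮(s)` which sends the unitaries `s i` to unitaries `r i` extends to a
`⋆`-homomorphism `C⋆(s) → C⋆(r)`. -/
theorem IsUCP.exists_starAlgHom (hs : ∀ i, s i ∈ unitary A) (hr : ∀ i, r i ∈ unitary B)
    {φ : generatedBy s →ₗ[ℂ] B} (hφ : IsUCP φ) (hφs : ∀ i, φ (gen s i) = r i) :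
    ∃ π : (generatedBy s).cstar →⋆ₐ[ℂ] B, (∀ a, π a ∈ (generatedBy r).cstar) ∧
      ∀ x, π (toCstar _ x) = φ x := by
  let U : Set (A × B) :=
    {1} ∪ (Set.range fun i => (s i, r i)) ∪ Set.range fun i => (star (s i), star (r i))
  have hfin : U.Finite :=
    ((Set.finite_singleton _).union (Set.finite_range _)).union (Set.finite_range _)
  have hone : 1 ∈ U := Or.inl (Or.inl rfl)
  have hle : star U ⊆ U := by
    rintro x ((hx | ⟨i, hx⟩) | ⟨i, hx⟩)
    · exact Or.inl (Or.inl (by rw [← star_star x, Set.mem_singleton_iff.mp hx]; exact star_one _))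
    · exact Or.inr ⟨i, by rw [← star_star x, ← hx]; rfl⟩
    · exact Or.inl (Or.inr ⟨i, by rw [← star_star x, ← hx]; ext <;> simp⟩)
  have hstar : star U = U := hle.antisymm (by simpa using Set.star_subset_star.mpr hle)
  have hunit : ∀ u ∈ U, star u * u = 1 := by
    rintro x ((rfl | ⟨i, rfl⟩) | ⟨i, rfl⟩)
    · simp
    · exact Prod.ext (hs i).1 (hr i).1
    · ext
      · simpa using (hs i).2
      · simpa using (hr i).2
  have hφstar : ∀ i, φ ⟨star (s i), star_mem (mem_generatedBy s i)⟩ = star (r i) := fun i => by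
    rw [← hφs]
    exact hφ.map_star_of_unitary (u := gen s i) (hs i).1 rfl
  have hgraph : ∀ x ∈ Submodule.span ℂ U, ∃ y : generatedBy s, (y : A) = x.1 ∧ φ y = x.2 := by
    intro x hx
    induction hx using Submodule.span_induction with
    | mem x hx =>
      rcases hx with (rfl | ⟨i, rfl⟩) | ⟨i, rfl⟩
      · exact ⟨1, rfl, hφ.map_one⟩
      · exact ⟨gen s i, rfl, hφs i⟩
      · exact ⟨⟨star (s i), star_mem (mem_generatedBy s i)⟩, rfl, hφstar i⟩
    | zero => exact ⟨0, rfl, map_zero φ⟩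
    | add x y _ _ hx hy =>
      obtain ⟨x', h1, h2⟩ := hx
      obtain ⟨y', h3, h4⟩ := hy
      exact ⟨x' + y', by rw [Prod.fst_add, ← h1, ← h3]; rfl, by rw [map_add, h2, h4]; rfl⟩
    | smul c x _ hx =>
      obtain ⟨x', h1, h2⟩ := hx
      exact ⟨c • x', by rw [Prod.smul_fst, ← h1]; rfl, by rw [map_smul, h2]; rfl⟩
  have hmem : ∀ i, (s i, r i) ∈ StarAlgebra.adjoin ℂ U := fun i =>
    StarAlgebra.subset_adjoin ℂ U (Or.inl (Or.inr ⟨i, rfl⟩))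
  obtain ⟨π, hπ, hπD⟩ := exists_starAlgHom_of_norm_le (D := StarAlgebra.adjoin ℂ U)
    (fun x hx => norm_snd_le_norm_fst hfin hone hstar hunit (hφ.matMono hgraph) hx)
    (S := (generatedBy s).cstar) (by
      rw [cstar_generatedBy]
      refine StarSubalgebra.topologicalClosure_mono (StarAlgebra.adjoin_le ?_)
      rintro _ ⟨i, rfl⟩
      exact ⟨_, hmem i, rfl⟩)
  refine ⟨π, fun a => ?_, fun x => ?_⟩
  -- Second components of `D` are `⋆`-polynomials in `r`; passing to the closure puts the values of
  -- `π` in `C⋆(r)`.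
  · have hD : StarAlgebra.adjoin ℂ U
        ≤ (StarAlgebra.adjoin ℂ (Set.range r)).comap (StarAlgHom.snd ℂ A B) := by
      refine StarAlgebra.adjoin_le ?_
      rintro x ((rfl | ⟨i, rfl⟩) | ⟨i, rfl⟩)
      · exact one_mem _
      · exact StarAlgebra.subset_adjoin ℂ _ ⟨i, rfl⟩
      · exact star_mem (StarAlgebra.subset_adjoin ℂ (Set.range r) ⟨i, rfl⟩)
    rw [cstar_generatedBy]
    exact map_mem_closure (f := Prod.snd) (s := (StarAlgebra.adjoin ℂ U : Set (A × B)))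
      (t := (StarAlgebra.adjoin ℂ (Set.range r) : Set B)) continuous_snd (hπ a) fun y hy => hD hy
  · refine hπD _ _ (?_ : ((x : A), φ x) ∈ StarAlgebra.adjoin ℂ U)
    induction x using span_induction_generatedBy with
    | one => rw [hφ.map_one]; exact one_mem _
    | gen i => rw [hφs]; exact hmem i
    | star_gen i => rw [hφstar]; exact star_mem (hmem i)
    | add x y hx hy => rw [map_add]; exact add_mem hx hy
    | smul c x hx => rw [map_smul]; exact SMulMemClass.smul_mem c hx

/-- A UCP map on `C⋆(s)` that agrees with a `⋆`-homomorphism on the unitaries `s i` is equal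
to it. -/
theorem IsUCP.eq_starAlgHom (hs : ∀ i, s i ∈ unitary A)
    {Φ : (generatedBy s).cstar →ₗ[ℂ] B} (hΦ : IsUCP Φ) (π : (generatedBy s).cstar →⋆ₐ[ℂ] B)
    (h : ∀ i, Φ (toCstar _ (gen s i)) = π (toCstar _ (gen s i))) (a : (generatedBy s).cstar) :
    Φ a = π a := by
  let T := (generatedBy s).cstar
  have hu : ∀ i, star (toCstar _ (gen s i)) * toCstar _ (gen s i) = 1 := fun i =>
    Subtype.ext (hs i).1
  have hu' : ∀ i, toCstar _ (gen s i) * star (toCstar _ (gen s i)) = 1 := fun i =>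
    Subtype.ext (hs i).2
  have hstar : ∀ i, Φ (star (toCstar _ (gen s i))) = π (star (toCstar _ (gen s i))) := fun i => by
    rw [map_star π, ← h]
    exact hΦ.map_star_of_unitary (hs i).1 rfl
  -- Quantifying over all `x` makes the condition on `a` stable under products; it is one-sided, so
  -- adjoints of generators are treated as further unitaries. Taking `x = 1` gives agreement with
  -- `π`.
  have hmul : ∀ a ∈ Algebra.adjoin ℂ (Set.range s ∪ star (Set.range s)), ∃ ha : a ∈ T,
      ∀ x : T, Φ (x * ⟨a, ha⟩) = Φ x * π ⟨a, ha⟩ := by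
    intro a ha
    induction ha using Algebra.adjoin_induction with
    | mem a ha =>
      rcases ha with ⟨i, rfl⟩ | ⟨i, hi⟩
      · refine ⟨(toCstar _ (gen s i)).2, fun x => ?_⟩
        change Φ (x * toCstar _ (gen s i)) = Φ x * π (toCstar _ (gen s i))
        rw [hΦ.map_mul_of_unitary (hs i).1 (by rw [h, ← map_star π, ← map_mul π, hu]; exact _root_.map_one π), h]
      · obtain rfl : a = star (s i) := by rw [hi, star_star]
        refine ⟨(star (toCstar _ (gen s i))).2, fun x => ?_⟩
        change Φ (x * star (toCstar _ (gen s i))) = Φ x * π (star (toCstar _ (gen s i)))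
        rw [hΦ.map_mul_of_unitary (by simpa using congrArg Subtype.val (hu' i))
          (by rw [hstar, ← map_star π, ← map_mul π, star_star, hu']; exact _root_.map_one π), hstar]
    | algebraMap c =>
      refine ⟨algebraMap_mem T c, fun x => ?_⟩
      change Φ (x * algebraMap ℂ T c) = Φ x * π (algebraMap ℂ T c)
      rw [AlgHomClass.commutes, ← Algebra.commutes, ← Algebra.commutes, ← Algebra.smul_def,
        ← Algebra.smul_def, map_smul]
    | add a b _ _ ha hb =>
      obtain ⟨ha, h1⟩ := ha
      obtain ⟨hb, h2⟩ := hb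
      refine ⟨add_mem ha hb, fun x => ?_⟩
      change Φ (x * (⟨a, ha⟩ + ⟨b, hb⟩)) = Φ x * π (⟨a, ha⟩ + ⟨b, hb⟩)
      rw [mul_add, map_add, h1, h2, map_add, mul_add]
    | mul a b _ _ ha hb =>
      obtain ⟨ha, h1⟩ := ha
      obtain ⟨hb, h2⟩ := hb
      refine ⟨mul_mem ha hb, fun x => ?_⟩
      change Φ (x * (⟨a, ha⟩ * ⟨b, hb⟩)) = Φ x * π (⟨a, ha⟩ * ⟨b, hb⟩)
      rw [← mul_assoc, h2, h1, map_mul, mul_assoc]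
  let W : Set T := {x | (x : A) ∈ StarAlgebra.adjoin ℂ (Set.range s)}
  have hW : Dense W := by
    refine Subtype.dense_iff.mpr fun a ha => ?_
    have hle : StarAlgebra.adjoin ℂ (Set.range s) ≤ T := by
      rw [show T = _ from cstar_generatedBy s]
      exact StarSubalgebra.le_topologicalClosure _
    have ha' : a ∈ (StarAlgebra.adjoin ℂ (Set.range s)).topologicalClosure := by
      rw [← cstar_generatedBy]
      exact ha
    have hsub : (StarAlgebra.adjoin ℂ (Set.range s) : Set A) ⊆ (↑) '' W :=
      fun x hx => ⟨⟨x, hle hx⟩, hx, rfl⟩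
    exact closure_mono hsub ha'
  have hπ : Continuous π := (isUCP_of_starAlgHom π).continuous
  refine congrFun (Continuous.ext_on hW hΦ.continuous hπ fun x hx => ?_) a
  obtain ⟨hx', hx1⟩ := hmul _ hx
  have := hx1 1
  rwa [one_mul, hΦ.map_one, one_mul] at this

-- Both `ρ ∘ π` and the identity, followed by the inclusion into `A`, are `⋆`-homomorphisms that
-- agree on the generators, so `IsUCP.eq_starAlgHom` identifies them.
omit [PartialOrder B] [StarOrderedRing B] in
theorem starAlgHom_comp_apply (hs : ∀ i, s i ∈ unitary A)
    (π : (generatedBy s).cstar →⋆ₐ[ℂ] (generatedBy r).cstar)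
    (ρ : (generatedBy r).cstar →⋆ₐ[ℂ] (generatedBy s).cstar)
    (hπ : ∀ i, π (toCstar _ (gen s i)) = toCstar _ (gen r i))
    (hρ : ∀ i, ρ (toCstar _ (gen r i)) = toCstar _ (gen s i)) (a : (generatedBy s).cstar) :
    ρ (π a) = a := by
  let ι := (generatedBy s).cstar.subtype
  refine Subtype.ext ((isUCP_of_starAlgHom (ι.comp (ρ.comp π))).eq_starAlgHom hs ι (fun i => ?_) a)
  change ι (ρ (π _)) = _
  rw [hπ, hρ]

theorem IsCompleteOrderIso.isUCP {S : OperatorSystem A} {R : OperatorSystem B} {φ : S ≃ₗ[ℂ] R}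
    (hφ : IsCompleteOrderIso φ) : IsUCP (toAmbient φ.toLinearMap) :=
  ⟨congrArg Subtype.val hφ.map_one, hφ.nPositive⟩

theorem IsCompleteOrderIso.symm {S : OperatorSystem A} {R : OperatorSystem B} {φ : S ≃ₗ[ℂ] R}
    (hφ : IsCompleteOrderIso φ) : IsCompleteOrderIso φ.symm :=
  ⟨by rw [← hφ.map_one, φ.symm_apply_apply], hφ.nPositive_symm, hφ.nPositive⟩

/-- A complete order isomorphism with `s i ↦ r i` extends to a `⋆`-isomorphism
`C⋆(s) ≃ C⋆(r)`. -/
theorem IsCompleteOrderIso.exists_starAlgEquiv (hs : ∀ i, s i ∈ unitary A)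
    (hr : ∀ i, r i ∈ unitary B) {φ : generatedBy s ≃ₗ[ℂ] generatedBy r}
    (hφ : IsCompleteOrderIso φ) (hφs : ∀ i, φ (gen s i) = gen r i) :
    ∃ π : (generatedBy s).cstar ≃⋆ₐ[ℂ] (generatedBy r).cstar,
      ∀ x, (π (toCstar _ x) : B) = φ x := by
  obtain ⟨π, hπ, hπφ⟩ := hφ.isUCP.exists_starAlgHom hs hr fun i => congrArg Subtype.val (hφs i)
  obtain ⟨ρ, hρ, hρφ⟩ := hφ.symm.isUCP.exists_starAlgHom hr hs fun i =>
    congrArg Subtype.val (show φ.symm (gen r i) = gen s i by rw [← hφs, φ.symm_apply_apply])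
  let π' := StarAlgHom.codRestrict π _ hπ
  let ρ' := StarAlgHom.codRestrict ρ _ hρ
  have h1 : ∀ i, π' (toCstar _ (gen s i)) = toCstar _ (gen r i) := fun i =>
    Subtype.ext ((hπφ _).trans (congrArg Subtype.val (hφs i)))
  have h2 : ∀ i, ρ' (toCstar _ (gen r i)) = toCstar _ (gen s i) := fun i =>
    Subtype.ext ((hρφ _).trans (congrArg Subtype.val
      (show φ.symm (gen r i) = gen s i by rw [← hφs, φ.symm_apply_apply])))
  exact ⟨StarAlgEquiv.ofStarAlgHom π' ρ'
    (StarAlgHom.ext fun b => starAlgHom_comp_apply hs π' ρ' h1 h2 b)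
    (StarAlgHom.ext fun a => starAlgHom_comp_apply hr ρ' π' h2 h1 a), hπφ⟩

omit [PartialOrder A] [StarOrderedRing A] [PartialOrder B] [StarOrderedRing B] in
theorem starAlgHom_mem_generatedBy (π : (generatedBy s).cstar →⋆ₐ[ℂ] (generatedBy r).cstar)
    (hπ : ∀ i, (π (toCstar _ (gen s i)) : B) = r i) (x : generatedBy s) :
    (π (toCstar _ x) : B) ∈ generatedBy r := by
  induction x using span_induction_generatedBy with
  | one =>
    rw [show toCstar (generatedBy s) 1 = 1 from rfl, map_one]
    exact one_mem (generatedBy r)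
  | gen i => rw [hπ]; exact mem_generatedBy r i
  | star_gen i =>
    rw [show toCstar (generatedBy s) ⟨star (s i), star_mem (mem_generatedBy s i)⟩
      = star (toCstar _ (gen s i)) from rfl, map_star, StarMemClass.coe_star, hπ]
    exact star_mem (mem_generatedBy r i)
  | add x y hx hy =>
    rw [show toCstar (generatedBy s) (x + y) = toCstar _ x + toCstar _ y from rfl, map_add]
    exact add_mem hx hy
  | smul c x hx =>
    rw [show toCstar (generatedBy s) (c • x) = c • toCstar _ x from rfl, map_smul]
    exact SMulMemClass.smul_mem c hx

/-- The restriction to `𝒮(s) → 𝒮(r)` of a `⋆`-homomorphism `C⋆(s) → C⋆(r)` with `s i ↦ r i`. -/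
noncomputable def restrictStarAlgHom (π : (generatedBy s).cstar →⋆ₐ[ℂ] (generatedBy r).cstar)
    (hπ : ∀ i, (π (toCstar _ (gen s i)) : B) = r i) : generatedBy s →ₗ[ℂ] generatedBy r where
  toFun x := ⟨π (toCstar _ x), starAlgHom_mem_generatedBy π hπ x⟩
  map_add' x y := by
    have := congrArg Subtype.val (map_add π (toCstar _ x) (toCstar _ y))
    exact Subtype.ext this
  map_smul' c x := by
    have := congrArg Subtype.val (map_smul π c (toCstar _ x))
    exact Subtype.ext this

theorem isNPositive_restrictStarAlgHom (π : (generatedBy s).cstar →⋆ₐ[ℂ] (generatedBy r).cstar)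
    (hπ : ∀ i, (π (toCstar _ (gen s i)) : B) = r i) (n : ℕ) :
    IsNPositive n (fun x : generatedBy s => (restrictStarAlgHom π hπ x : B)) := fun M hM =>
  (isUCP_of_starAlgHom ((generatedBy r).cstar.subtype.comp π)).nPositive n (M.map (toCstar _)) hM

theorem exists_isCompleteOrderIso (π : (generatedBy s).cstar ≃⋆ₐ[ℂ] (generatedBy r).cstar)
    (hπ : ∀ i, (π (toCstar _ (gen s i)) : B) = r i) :
    ∃ φ : generatedBy s ≃ₗ[ℂ] generatedBy r, IsCompleteOrderIso φ ∧
      ∀ i, φ (gen s i) = gen r i := by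
  have hπ' : ∀ i, (π.symm (toCstar _ (gen r i)) : A) = s i := fun i => by
    rw [← show π (toCstar _ (gen s i)) = toCstar _ (gen r i) from Subtype.ext (hπ i),
      StarAlgEquiv.symm_apply_apply]
    rfl
  let f := restrictStarAlgHom (π : (generatedBy s).cstar →⋆ₐ[ℂ] (generatedBy r).cstar) hπ
  let g := restrictStarAlgHom (π.symm : (generatedBy r).cstar →⋆ₐ[ℂ] (generatedBy s).cstar) hπ'
  have hfg : f ∘ₗ g = LinearMap.id := LinearMap.ext fun y => by
    have := congrArg Subtype.val (π.apply_symm_apply (toCstar _ y))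
    exact Subtype.ext this
  have hgf : g ∘ₗ f = LinearMap.id := LinearMap.ext fun x => by
    have := congrArg Subtype.val (π.symm_apply_apply (toCstar _ x))
    exact Subtype.ext this
  have hone := congrArg Subtype.val (map_one π)
  exact ⟨LinearEquiv.ofLinearMap f g hfg hgf,
    ⟨Subtype.ext hone, isNPositive_restrictStarAlgHom _ hπ, isNPositive_restrictStarAlgHom _ hπ'⟩,
    fun i => Subtype.ext (hπ i)⟩

theorem isUCPExtension_starAlgHom {S : OperatorSystem A} {φ : S →ₗ[ℂ] B}
    (π : S.cstar →⋆ₐ[ℂ] B) (hπ : ∀ x, π (toCstar _ x) = φ x) :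
    IsUCPExtension φ π.toAlgHom.toLinearMap :=
  ⟨isUCP_of_starAlgHom π, hπ⟩

theorem IsUCPExtension.eq_starAlgHom (hs : ∀ i, s i ∈ unitary A) {φ : generatedBy s →ₗ[ℂ] B}
    {Ψ : (generatedBy s).cstar →ₗ[ℂ] B} (hΨ : IsUCPExtension φ Ψ)
    (π : (generatedBy s).cstar →⋆ₐ[ℂ] B) (hπ : ∀ x, π (toCstar _ x) = φ x) :
    Ψ = π.toAlgHom.toLinearMap :=
  LinearMap.ext (hΨ.isUCP.eq_starAlgHom hs π fun i => by rw [hΨ.extends_map, hπ])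

end Generated

end OperatorSystem

theorem mainTheorem11 {A B : Type*}
    [CStarAlgebra A] [PartialOrder A] [StarOrderedRing A]
    [CStarAlgebra B] [PartialOrder B] [StarOrderedRing B]
    (d : ℕ) (s : Fin d → A) (r : Fin d → B)
    (hs : ∀ i, s i ∈ unitary A) (hr : ∀ i, r i ∈ unitary B) :
    -- a UCP map `𝒮(s) → 𝒮(r)` with `s i ↦ r i` has the unique extension property
    (∀ φ : OperatorSystem.generatedBy s →ₗ[ℂ] OperatorSystem.generatedBy r,
      OperatorSystem.IsUCP (OperatorSystem.toAmbient φ) →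
      (∀ i, φ (OperatorSystem.gen s i) = OperatorSystem.gen r i) →
      OperatorSystem.HasUniqueExtensionProperty (OperatorSystem.toAmbient φ)) ∧
    -- `s i ↦ r i` defines a complete order isomorphism iff it extends to a `⋆`-isomorphism
    ((∃ φ : OperatorSystem.generatedBy s ≃ₗ[ℂ] OperatorSystem.generatedBy r,
        OperatorSystem.IsCompleteOrderIso φ ∧
        ∀ i, φ (OperatorSystem.gen s i) = OperatorSystem.gen r i) ↔
      ∃ π : (OperatorSystem.generatedBy s).cstar ≃⋆ₐ[ℂ] (OperatorSystem.generatedBy r).cstar,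
        ∀ i, (π (OperatorSystem.toCstar _ (OperatorSystem.gen s i)) : B) = r i) ∧
    -- in that case the `⋆`-isomorphism is the unique UCP extension
    (∀ φ : OperatorSystem.generatedBy s ≃ₗ[ℂ] OperatorSystem.generatedBy r,
      OperatorSystem.IsCompleteOrderIso φ →
      (∀ i, φ (OperatorSystem.gen s i) = OperatorSystem.gen r i) →
      ∃ (π : (OperatorSystem.generatedBy s).cstar ≃⋆ₐ[ℂ] (OperatorSystem.generatedBy r).cstar)
        (Φ : (OperatorSystem.generatedBy s).cstar →ₗ[ℂ] B),
        (∀ a, Φ a = (π a : B)) ∧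
        OperatorSystem.IsUCPExtension (OperatorSystem.toAmbient φ.toLinearMap) Φ ∧
        ∀ Ψ : (OperatorSystem.generatedBy s).cstar →ₗ[ℂ] B,
          OperatorSystem.IsUCPExtension (OperatorSystem.toAmbient φ.toLinearMap) Ψ → Ψ = Φ) := by
  refine ⟨fun φ hφ hφs => ?_, ⟨?_, ?_⟩, fun φ hφ hφs => ?_⟩
  · obtain ⟨π, -, hπ⟩ := hφ.exists_starAlgHom hs hr fun i => congrArg Subtype.val (hφs i)
    exact ⟨⟨_, OperatorSystem.isUCPExtension_starAlgHom π hπ, fun Ψ hΨ => hΨ.eq_starAlgHom hs π hπ⟩,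
      fun Ψ hΨ => ⟨π, fun a => by rw [hΨ.eq_starAlgHom hs π hπ]; rfl⟩⟩
  · rintro ⟨φ, hφ, hφs⟩
    obtain ⟨π, hπ⟩ := hφ.exists_starAlgEquiv hs hr hφs
    exact ⟨π, fun i => by rw [hπ, hφs]; rfl⟩
  · rintro ⟨π, hπ⟩
    exact OperatorSystem.exists_isCompleteOrderIso π hπ
  · obtain ⟨π, hπ⟩ := hφ.exists_starAlgEquiv hs hr hφs
    let π' := (OperatorSystem.generatedBy r).cstar.subtype.comp
      (π : (OperatorSystem.generatedBy s).cstar →⋆ₐ[ℂ] (OperatorSystem.generatedBy r).cstar)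
    exact ⟨π, π'.toAlgHom.toLinearMap, fun _ => rfl,
      OperatorSystem.isUCPExtension_starAlgHom π' hπ, fun Ψ hΨ => hΨ.eq_starAlgHom hs π' hπ⟩
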